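/- Let $1<p<2<q<\infty$ with $\frac1p-\frac1q=\frac12$. Let $u\in L^p(\mathbb{R}^2)\cap L^q(\mathbb{R}^2)$ and $V\in L^2(\mathbb{R}^2)$ be complex-valued. Write $\overline{\partial}=\frac12(i\partial_y+\partial_x)$. Suppose that the distributional derivative $\overline{\partial}u$ is a locally integrable function, i.e. there is $w\in L^1_{\mathrm{loc}}(\mathbb{R}^2)$ with $$\int_{\mathbb{R}^2} u\,\overline{\partial}\varphi\,dx\,dy=-\int_{\mathbb{R}^2} w\,\varphi\,dx\,dy\qquad\text{for all complex-valued }\varphi\in C_c^\infty(\mathbb{R}^2),$$ and that $\overline{\partial}u:=w$ satisfies $$|\overline{\partial}u|\le|Vu|\qquad\text{almost everywhere in }\mathbb{R}^2.$$ If $u$ vanishes almost everywhere on some non-empty open subset of $\mathbb{R}^2$, then $u=0$ almost everywhere in $\mathbb{R}^2$. -/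

import Mathlib

open MeasureTheory
open scoped ContDiff

/-- The Cauchy-Riemann operator `(i ∂_y + ∂_x) / 2`, acting on (real-)differentiable complex-valued
functions on the plane with coordinates `(x, y)`. -/
noncomputable def dbar (φ : ℝ × ℝ → ℂ) (z : ℝ × ℝ) : ℂ :=
  (Complex.I * fderiv ℝ φ z (0, 1) + fderiv ℝ φ z (1, 0)) / 2

/-- `w` is the Cauchy-Riemann derivative of `u` in the sense of distributions: both functions are
locally integrable, and integration by parts holds against every smooth compactly supported
test function. -/
structure HasWeakDbar (u w : ℝ × ℝ → ℂ) : Prop where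
  locallyIntegrable : LocallyIntegrable u volume
  locallyIntegrable_deriv : LocallyIntegrable w volume
  integral_eq : ∀ φ : ℝ × ℝ → ℂ, ContDiff ℝ ∞ φ → HasCompactSupport φ →
    ∫ z, u z * dbar φ z = -∫ z, w z * φ z

/-- The differential inequality `|∂̄ u| ≤ |V u|`: the distributional Cauchy-Riemann derivative of `u`
is a locally integrable function, bounded by `|V u|` almost everywhere. -/
def SatisfiesDbarInequality (u V : ℝ × ℝ → ℂ) : Prop :=
  ∃ w : ℝ × ℝ → ℂ, HasWeakDbar u w ∧ ∀ᵐ z, ‖w z‖ ≤ ‖V z * u z‖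

/-!
The proof is a Carleman estimate with the singular weights `|z - z₀| ^ (-n)`.

Multiplication by the holomorphic function `(z - z₀) ^ (-n)` commutes with `∂̄`, so an inequality
`‖g‖_q ≤ A ‖∂̄ g‖_p` for all `g` gives the weighted inequality
`‖|z - z₀| ^ (-n) u‖_q ≤ A ‖|z - z₀| ^ (-n) ∂̄ u‖_p`,
with the same constant for every `n`, for all `u` that vanish near `z₀`.
Since `1 / p = 1 / 2 + 1 / q`, Hölder's inequality bounds the right-hand side, over a disc of
radius `ρ` around `z₀`, by `A ‖V‖_{L²(disc)} ‖|z - z₀| ^ (-n) u‖_q`, and this is at most half of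
the left-hand side when `ρ` is small. What remains is `≤ A ρ ^ (-n) ‖V u‖_p`, and `n → ∞` forces
`u = 0` on the disc of radius `ρ / 2` (`exists_ae_eq_zero_of_ae_eq_zero_near`). As `V ∈ L²`, the
same `ρ` serves all centres `z₀`, so the set of points near which `u` vanishes is open and closed.

The inequality `‖g‖_q ≤ A ‖∂̄ g‖_p` (`exists_eLpNorm_le_of_hasWeakDbar`) combines two facts.
* Almost everywhere, `|g|` is at most a constant times the convolution of `|z|⁻¹` with `|∂̄ g|`
  (`ae_enorm_le_rieszPotential`). Here a smooth
  function `cauchyKernel δ`, equal to `1 / z` for `|z| ≥ δ`, is used as a test function; its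
  `∂̄`-derivative is an approximate identity, up to a positive constant factor, as `δ → 0`.
  Nothing about the fundamental solution of `∂̄` or about weakly holomorphic functions is needed.
* The Hardy–Littlewood–Sobolev inequality for the kernel `|z|⁻¹`
  (`exists_lintegral_rieszPotential_rpow_le`), proved by real interpolation.
-/

/-! ### The Hardy–Littlewood–Sobolev inequality in the plane -/

section

open Set ENNReal

theorem lintegral_Ioi_indicator_rpow {m : ℝ} (hm : 0 < m) (t : ℝ≥0∞) :
    ∫⁻ a in Ioi (0 : ℝ), {a : ℝ | ENNReal.ofReal a < t}.indicator
      (fun a => ENNReal.ofReal (m * a ^ (m - 1))) a = t ^ m := by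
  have key : ∀ r : ℝ, 0 ≤ r → ∫⁻ a in Ioi (0 : ℝ), {a : ℝ | ENNReal.ofReal a < .ofReal r}.indicator
      (fun a => ENNReal.ofReal (m * a ^ (m - 1))) a = ENNReal.ofReal r ^ m := by
    intro r hr
    have hms : MeasurableSet {a : ℝ | ENNReal.ofReal a < .ofReal r} :=
      measurableSet_lt (by fun_prop) measurable_const
    rw [lintegral_indicator hms, Measure.restrict_restrict hms]
    have hset : {a : ℝ | ENNReal.ofReal a < .ofReal r} ∩ Ioi 0 = Ioo 0 r := by
      ext a
      simp only [mem_inter_iff, mem_ofPred_eq, mem_Ioi, mem_Ioo]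
      constructor
      · rintro ⟨h1, h2⟩
        exact ⟨h2, (ENNReal.ofReal_lt_ofReal_iff_of_nonneg h2.le).1 h1⟩
      · rintro ⟨h1, h2⟩
        exact ⟨(ENNReal.ofReal_lt_ofReal_iff_of_nonneg h1.le).2 h2, h1⟩
    rw [hset, restrict_Ioo_eq_restrict_Ioc, ← ofReal_integral_eq_lintegral_ofReal,
      ← intervalIntegral.integral_of_le hr, intervalIntegral.integral_const_mul,
      integral_rpow (Or.inl (by linarith)), ENNReal.ofReal_rpow_of_nonneg hr hm.le]
    · congr 1
      rw [sub_add_cancel, Real.zero_rpow hm.ne']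
      field_simp
      ring
    · rw [← IntegrableOn, ← intervalIntegrable_iff_integrableOn_Ioc_of_le hr]
      exact (intervalIntegral.intervalIntegrable_rpow' (by linarith)).const_mul _
    · filter_upwards [ae_restrict_mem measurableSet_Ioc] with a ha
      have := ha.1
      positivity
  induction t using ENNReal.recTopCoe with
  | coe t => simpa using key t t.2
  | top =>
    rw [ENNReal.top_rpow_of_pos hm, eq_top_iff]
    refine ENNReal.le_of_forall_nnreal_lt fun r _ => ?_
    have h := key ((r : ℝ) ^ m⁻¹) (by positivity)
    rw [ENNReal.ofReal_rpow_of_nonneg (by positivity) hm.le, ← Real.rpow_mul r.coe_nonneg,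
      inv_mul_cancel₀ hm.ne', Real.rpow_one, ENNReal.ofReal_coe_nnreal] at h
    rw [← h]
    refine lintegral_mono fun a => ?_
    refine indicator_le_indicator_of_subset (fun a _ => ?_) (fun _ => zero_le) a
    simp

/-- Layer-cake formula for `ℝ≥0∞`-valued functions; unlike the real-valued version of Mathlib, it
allows the value `∞`, so that fractional integrals need no a priori finiteness. -/
theorem lintegral_rpow_eq_lintegral_measure_lt {α : Type*} [MeasurableSpace α] (ν : Measure α)
    [SFinite ν] {f : α → ℝ≥0∞} (hf : Measurable f) {m : ℝ} (hm : 0 < m) :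
    ∫⁻ y, f y ^ m ∂ν =
      ∫⁻ a in Ioi (0 : ℝ), ENNReal.ofReal (m * a ^ (m - 1)) * ν {y | ENNReal.ofReal a < f y} := by
  simp_rw [← lintegral_Ioi_indicator_rpow hm]
  have hms : MeasurableSet {x : α × ℝ | ENNReal.ofReal x.2 < f x.1} :=
    measurableSet_lt (by fun_prop) (by fun_prop)
  rw [lintegral_lintegral_swap]
  · refine lintegral_congr fun a => ?_
    rw [← lintegral_indicator_const (measurableSet_lt measurable_const hf)]
    rfl
  · have : Measurable ({x : α × ℝ | ENNReal.ofReal x.2 < f x.1}.indicator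
        (fun x => ENNReal.ofReal (m * x.2 ^ (m - 1)))) := Measurable.indicator (by fun_prop) hms
    exact this.aemeasurable

theorem lintegral_eq_lintegral_measure_ofReal_lt {α : Type*} [MeasurableSpace α] (ν : Measure α)
    [SFinite ν] {f : α → ℝ≥0∞} (hf : Measurable f) :
    ∫⁻ y, f y ∂ν = ∫⁻ a in Ioi (0 : ℝ), ν {y | ENNReal.ofReal a < f y} := by
  simpa using lintegral_rpow_eq_lintegral_measure_lt ν hf one_pos

/-- The kernel `‖x - ·‖⁻¹` is in weak `L ^ 2`, uniformly in `x`: its superlevel set at the height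
`a` is a square of area `4 / a ^ 2`. -/
theorem setLIntegral_inv_enorm_sub_le (x : ℝ × ℝ) (F : Set (ℝ × ℝ)) :
    ∫⁻ y in F, ‖x - y‖ₑ⁻¹ ≤ 5 * volume F ^ (1 / 2 : ℝ) := by
  rcases eq_or_ne (volume F) 0 with h0 | h0
  · rw [Measure.restrict_eq_zero.2 h0]; simp
  rcases eq_or_ne (volume F) ⊤ with h1 | h1
  · rw [h1, ENNReal.top_rpow_of_pos (by norm_num)]; simp
  rw [lintegral_eq_lintegral_measure_ofReal_lt _ (by fun_prop)]
  obtain ⟨v, hv, hvF⟩ : ∃ v : ℝ, 0 < v ∧ volume F = ENNReal.ofReal (v ^ 2) := by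
    refine ⟨√(volume F).toReal, Real.sqrt_pos.2 (ENNReal.toReal_pos h0 h1), ?_⟩
    rw [Real.sq_sqrt ENNReal.toReal_nonneg, ENNReal.ofReal_toReal h1]
  have hR : 5 * volume F ^ (1 / 2 : ℝ) = ENNReal.ofReal (v ^ 2) * ENNReal.ofReal (v⁻¹)
      + ENNReal.ofReal (4 * v) := by
    rw [hvF, ENNReal.ofReal_rpow_of_nonneg (by positivity) (by norm_num), ← Real.sqrt_eq_rpow,
      Real.sqrt_sq hv.le, ← ENNReal.ofReal_mul (by positivity),
      ← ENNReal.ofReal_add (by positivity) (by positivity),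
      show (5 : ℝ≥0∞) = ENNReal.ofReal 5 by simp, ← ENNReal.ofReal_mul (by norm_num)]
    congr 1
    field_simp
    ring
  -- below the height `v⁻¹` use the measure of `F`, above it the measure of the square
  rw [hR, ← Ioc_union_Ioi_eq_Ioi (inv_pos.2 hv).le]
  refine (lintegral_union_le _ _ _).trans (add_le_add ?_ ?_)
  · calc _ ≤ ∫⁻ a in Ioc 0 v⁻¹, volume F := by
          refine lintegral_mono fun a => ?_
          exact (measure_mono (subset_univ _)).trans (by simp)
      _ = _ := by simp [hvF]
  · calc _ ≤ ∫⁻ a in Ioi v⁻¹, ENNReal.ofReal (4 * a ^ (-2 : ℝ)) := by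
          refine setLIntegral_mono (by fun_prop) fun a ha => ?_
          have ha0 : 0 < a := (inv_pos.2 hv).trans ha
          refine (Measure.restrict_apply_le _ _).trans ?_
          have hsub : {y | ENNReal.ofReal a < ‖x - y‖ₑ⁻¹} ⊆ Metric.ball x a⁻¹ := by
            intro y hy
            simp only [mem_ofPred_eq] at hy
            rw [ENNReal.lt_inv_iff_lt_inv, ← ENNReal.ofReal_inv_of_pos ha0,
              ← ofReal_norm, ENNReal.ofReal_lt_ofReal_iff (by positivity)] at hy
            rwa [Metric.mem_ball, dist_comm, dist_eq_norm]
          refine (measure_mono hsub).trans ?_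
          rw [← Prod.mk.eta (p := x), ← ball_prod_same, Measure.volume_eq_prod, Measure.prod_prod,
            Real.volume_ball, Real.volume_ball, ← ENNReal.ofReal_mul (by positivity)]
          refine ENNReal.ofReal_le_ofReal (le_of_eq ?_)
          rw [Real.rpow_neg ha0.le, Real.rpow_two]
          field_simp
          norm_num
      _ = _ := by
          have hi := integrableOn_Ioi_rpow_of_lt (show (-2 : ℝ) < -1 by norm_num) (inv_pos.2 hv)
          rw [← ofReal_integral_eq_lintegral_ofReal (hi.const_mul _), integral_const_mul,
            integral_Ioi_rpow_of_lt (by norm_num) (inv_pos.2 hv)]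
          · congr 1
            norm_num
            rw [Real.rpow_neg_one, inv_inv]
          · filter_upwards [ae_restrict_mem measurableSet_Ioi] with a ha
            have : 0 < a := (inv_pos.2 hv).trans ha
            positivity

/-- The fractional integral of order one of a non-negative function on the plane. The kernel is
`‖x - y‖⁻¹` for the sup norm of `ℝ × ℝ`, which dominates the Euclidean kernel. -/
noncomputable def rieszPotential (f : ℝ × ℝ → ENNReal) (x : ℝ × ℝ) : ENNReal :=
  ∫⁻ y, f y * ‖x - y‖ₑ⁻¹

theorem measurable_rieszPotential {f : ℝ × ℝ → ℝ≥0∞} (hf : Measurable f) :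
    Measurable (rieszPotential f) := by
  unfold rieszPotential
  exact Measurable.lintegral_prod_right' (f := fun z : (ℝ × ℝ) × (ℝ × ℝ) => f z.2 * ‖z.1 - z.2‖ₑ⁻¹)
    (by fun_prop)

/-- The part of `f` below the height `s` has a bounded fractional integral. -/
theorem rieszPotential_min_le {p : ℝ} (hp2 : p < 2)
    {f : ℝ × ℝ → ℝ≥0∞} (hf : Measurable f) (hp : 1 < p)
    (hf1 : ∫⁻ y, f y ^ p ≤ 1) {s : ℝ} (hs : 0 < s)
    (x : ℝ × ℝ) :
    rieszPotential (fun y => min (f y) (ENNReal.ofReal s)) x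
      ≤ ENNReal.ofReal (10 / (2 - p) * s ^ ((2 - p) / 2)) := by
  have hk : Measurable fun y : ℝ × ℝ => ‖x - y‖ₑ⁻¹ := by fun_prop
  have h1 : rieszPotential (fun y => min (f y) (ENNReal.ofReal s)) x
      = ∫⁻ y, min (f y) (ENNReal.ofReal s) ∂(volume.withDensity fun y => ‖x - y‖ₑ⁻¹) := by
    rw [lintegral_withDensity_eq_lintegral_mul _ hk (by fun_prop)]
    exact lintegral_congr fun y => mul_comm _ _
  rw [h1, lintegral_eq_lintegral_measure_ofReal_lt _ (by fun_prop)]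
  have hpos : ∀ a : ℝ, 0 < a → (volume.withDensity fun y : ℝ × ℝ => ‖x - y‖ₑ⁻¹)
      {y | ENNReal.ofReal a < min (f y) (ENNReal.ofReal s)} ≤
        (Ioc 0 s).indicator (fun a => ENNReal.ofReal (5 * a ^ (-(p / 2)))) a := by
    intro a ha
    by_cases has : a ≤ s
    · rw [indicator_of_mem (show a ∈ Ioc 0 s from ⟨ha, has⟩)]
      have hm : MeasurableSet {y | ENNReal.ofReal a < f y} := measurableSet_lt measurable_const hf
      refine (measure_mono (t := {y | ENNReal.ofReal a < f y})
        fun y hy => by simp only [mem_ofPred_eq, lt_min_iff] at hy ⊢; exact hy.1).trans ?_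
      rw [withDensity_apply _ hm]
      refine (setLIntegral_inv_enorm_sub_le x _).trans ?_
      -- Chebyshev's inequality
      have hch : volume {y | ENNReal.ofReal a < f y} ≤ ENNReal.ofReal (a ^ (-p)) := by
        have hc := mul_meas_ge_le_lintegral (μ := (volume : Measure (ℝ × ℝ)))
          (f := fun y => f y ^ p) (by fun_prop) (ENNReal.ofReal a ^ p)
        have hsub : {y | ENNReal.ofReal a < f y} ⊆ {y | ENNReal.ofReal a ^ p ≤ f y ^ p} :=
          fun y hy => ENNReal.rpow_le_rpow (le_of_lt hy) (by linarith)
        have h2 := (mul_le_mul_right (measure_mono hsub) _).trans (hc.trans hf1)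
        rw [Real.rpow_neg ha.le, ENNReal.ofReal_inv_of_pos (by positivity),
          ← ENNReal.ofReal_rpow_of_pos ha]
        rw [← one_div, ENNReal.le_div_iff_mul_le (by left; positivity)
          (by left; exact ENNReal.rpow_ne_top_of_nonneg (by linarith) ENNReal.ofReal_ne_top),
          mul_comm]
        exact h2
      refine (mul_le_mul_right (ENNReal.rpow_le_rpow hch (by norm_num)) _).trans (le_of_eq ?_)
      rw [ENNReal.ofReal_rpow_of_pos (by positivity), ← Real.rpow_mul ha.le,
        show (5 : ℝ≥0∞) = ENNReal.ofReal 5 by simp, ← ENNReal.ofReal_mul (by norm_num)]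
      congr 3
      ring
    · have : {y | ENNReal.ofReal a < min (f y) (ENNReal.ofReal s)} = ∅ := by
        ext y
        simp only [mem_ofPred_eq, lt_min_iff, mem_empty_iff_false, iff_false, not_and, not_lt]
        exact fun _ => ENNReal.ofReal_le_ofReal (not_le.1 has).le
      rw [this]; simp
  refine (setLIntegral_mono' measurableSet_Ioi hpos).trans ?_
  rw [setLIntegral_indicator measurableSet_Ioc,
    inter_eq_left.2 (Ioc_subset_Ioi_self : Ioc 0 s ⊆ Ioi 0),
    ← ofReal_integral_eq_lintegral_ofReal, ← intervalIntegral.integral_of_le hs.le,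
    intervalIntegral.integral_const_mul, integral_rpow (Or.inl (by linarith))]
  · refine ENNReal.ofReal_le_ofReal (le_of_eq ?_)
    rw [Real.zero_rpow (by linarith), show -(p / 2) + 1 = (2 - p) / 2 by ring]
    field_simp
    ring
  · rw [← IntegrableOn, ← intervalIntegrable_iff_integrableOn_Ioc_of_le hs.le]
    exact (intervalIntegral.intervalIntegrable_rpow' (by linarith)).const_mul _
  · filter_upwards [ae_restrict_mem measurableSet_Ioc] with a ha
    have := ha.1
    positivity

/-- The fractional integral of order one is of weak type `(1, 2)`. -/
theorem measure_lt_rieszPotential_le {f : ℝ × ℝ → ℝ≥0∞} (hf : Measurable f) {t : ℝ} (ht : 0 < t) :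
    volume {x | ENNReal.ofReal t < rieszPotential f x}
      ≤ ENNReal.ofReal (25 / t ^ 2) * (∫⁻ y, f y) ^ 2 := by
  have hG : MeasurableSet {x | ENNReal.ofReal t < rieszPotential f x} :=
    measurableSet_lt measurable_const (measurable_rieszPotential hf)
  -- pass to a subset of finite measure, so that its measure can be cancelled below
  refine le_of_forall_lt fun r hr => ?_
  obtain ⟨G, hGm, hGs, hrG, hGt⟩ := Measure.exists_subset_measure_lt_top hG hr
  refine hrG.trans_le ?_
  have h1 : ENNReal.ofReal t * volume G ≤ 5 * volume G ^ (1 / 2 : ℝ) * ∫⁻ y, f y := by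
    calc ENNReal.ofReal t * volume G = ∫⁻ x in G, ENNReal.ofReal t := by simp
      _ ≤ ∫⁻ x in G, rieszPotential f x :=
          setLIntegral_mono (measurable_rieszPotential hf) fun x hx => le_of_lt (hGs hx)
      _ = ∫⁻ y, f y * ∫⁻ x in G, ‖y - x‖ₑ⁻¹ := by
          unfold rieszPotential
          rw [lintegral_lintegral_swap]
          · refine lintegral_congr fun y => ?_
            rw [lintegral_const_mul _ (by fun_prop)]
            simp_rw [enorm_sub_rev y]
          · exact Measurable.aemeasurable (f := fun z : (ℝ × ℝ) × (ℝ × ℝ) =>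
              f z.2 * ‖z.1 - z.2‖ₑ⁻¹) (by fun_prop)
      _ ≤ ∫⁻ y, f y * (5 * volume G ^ (1 / 2 : ℝ)) :=
          lintegral_mono fun y => mul_le_mul_right (setLIntegral_inv_enorm_sub_le y G) _
      _ = _ := by rw [lintegral_mul_const _ hf, mul_comm]
  rcases eq_or_ne (∫⁻ y, f y) ⊤ with hI | hI
  · rw [hI, ENNReal.top_pow two_ne_zero, ENNReal.mul_top]
    · exact le_top
    · simp; positivity
  obtain ⟨v, hv, hvG⟩ : ∃ v : ℝ, 0 ≤ v ∧ volume G = ENNReal.ofReal (v ^ 2) := by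
    refine ⟨√(volume G).toReal, Real.sqrt_nonneg _, ?_⟩
    rw [Real.sq_sqrt ENNReal.toReal_nonneg, ENNReal.ofReal_toReal hGt.ne]
  obtain ⟨I, hI0, hIf⟩ : ∃ I : ℝ, 0 ≤ I ∧ ∫⁻ y, f y = ENNReal.ofReal I :=
    ⟨_, ENNReal.toReal_nonneg, (ENNReal.ofReal_toReal hI).symm⟩
  rw [hIf, hvG] at h1 ⊢
  rw [ENNReal.ofReal_rpow_of_nonneg (by positivity) (by norm_num), ← Real.sqrt_eq_rpow,
      Real.sqrt_sq hv, show (5 : ℝ≥0∞) = ENNReal.ofReal 5 by simp,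
      ← ENNReal.ofReal_mul (by positivity), ← ENNReal.ofReal_mul (by positivity),
      ← ENNReal.ofReal_mul (by positivity),
      ENNReal.ofReal_le_ofReal_iff (by positivity)] at h1
  rw [← ENNReal.ofReal_pow hI0, ← ENNReal.ofReal_mul (by positivity)]
  refine ENNReal.ofReal_le_ofReal ?_
  rcases hv.eq_or_lt with rfl | hv
  · simp; positivity
  have h2 : t * v ≤ 5 * I := by
    refine le_of_mul_le_mul_right ?_ hv
    linarith
  have h3 : (t * v) ^ 2 ≤ (5 * I) ^ 2 := by gcongr
  rw [div_mul_eq_mul_div, le_div_iff₀ (by positivity)]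
  nlinarith

/-- The normalized Hardy–Littlewood–Sobolev inequality, by interpolation: at the level `t`, `f` is
cut at the height `t ^ (2 / (2 - p))`, for which the fractional integral of the low part is at
most a multiple of `t`; the weak-type bound for the high part is then integrated over `t`. -/
theorem lintegral_rieszPotential_rpow_le_of_le_one {p q : ℝ} (hp : 1 < p) (hp2 : p < 2)
    (hpq : 1 / p - 1 / q = 1 / 2) {f : ℝ × ℝ → ℝ≥0∞} (hf : Measurable f)
    (hf1 : ∫⁻ y, f y ^ p ≤ 1) :
    ∫⁻ x, rieszPotential f x ^ q ≤
      ENNReal.ofReal (20 / (2 - p)) ^ q * ENNReal.ofReal (q * (2 - p) ^ 3 / (8 * (p - 1))) := by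
  have h2p : 0 < 2 - p := by linarith
  have hp1 : 0 < p - 1 := by linarith
  have hq : q = 2 * p / (2 - p) := by
    have hq' : 1 / q = (2 - p) / (2 * p) := by
      rw [show 1 / q = 1 / p - 1 / 2 by linarith]
      field_simp
    rw [← one_div_one_div q, hq', one_div_div]
  have hq0 : 0 < q := by rw [hq]; positivity
  set A : ℝ := 10 / (2 - p) with hA
  have hA0 : 0 < A := by positivity
  -- the height at which `f` is cut at the level `t`
  set s : ℝ → ℝ := fun t => t ^ (2 / (2 - p)) with hs
  set m : ℝ := 2 * (p - 1) / (2 - p) with hm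
  have hm0 : 0 < m := by positivity
  have hlevel : ∀ t : ℝ, 0 < t →
      volume {x | ENNReal.ofReal t < (ENNReal.ofReal (2 * A))⁻¹ * rieszPotential f x} ≤
        ENNReal.ofReal (25 / (A * t) ^ 2 * s t ^ (1 - p)) *
          ∫⁻ y, {y | ENNReal.ofReal (s t) < f y}.indicator f y := by
    intro t ht
    have hst : 0 < s t := Real.rpow_pos_of_pos ht _
    have hms : MeasurableSet {y | ENNReal.ofReal (s t) < f y} :=
      measurableSet_lt measurable_const hf
    have hfs : Measurable ({y | ENNReal.ofReal (s t) < f y}.indicator f) := hf.indicator hms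
    have hsub : {x | ENNReal.ofReal t < (ENNReal.ofReal (2 * A))⁻¹ * rieszPotential f x} ⊆
        {x | ENNReal.ofReal (A * t) <
          rieszPotential ({y | ENNReal.ofReal (s t) < f y}.indicator f) x} := by
      intro x hx
      simp only [mem_ofPred_eq] at hx ⊢
      by_contra! hcon
      refine absurd hx (not_lt.2 ?_)
      have h1 := rieszPotential_min_le hp2 hf hp hf1 hst x
      rw [← Real.rpow_mul ht.le, show 2 / (2 - p) * ((2 - p) / 2) = 1 by field_simp,
        Real.rpow_one] at h1
      have h2 : rieszPotential f x ≤ ENNReal.ofReal (A * t) + ENNReal.ofReal (A * t) := by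
        refine le_trans ?_ (add_le_add h1 hcon)
        unfold rieszPotential
        rw [← lintegral_add_left (by fun_prop)]
        refine lintegral_mono fun y => ?_
        rw [← add_mul]
        refine mul_le_mul_left ?_ _
        by_cases hy : ENNReal.ofReal (s t) < f y
        · rw [indicator_of_mem (by exact hy)]; exact le_add_self
        · simp only [min_eq_left (not_lt.1 hy)]; exact le_self_add
      rw [← ENNReal.ofReal_add (by positivity) (by positivity),
        show A * t + A * t = (2 * A) * t by ring, ENNReal.ofReal_mul (by positivity)] at h2
      rw [mul_comm, ← div_eq_mul_inv]
      refine ENNReal.div_le_of_le_mul ?_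
      rwa [mul_comm]
    refine (measure_mono hsub).trans ((measure_lt_rieszPotential_le hfs (by positivity)).trans ?_)
    rw [ENNReal.ofReal_mul (by positivity), mul_assoc, sq (∫⁻ y, _)]
    refine mul_le_mul_right (mul_le_mul_left ?_ _) _
    calc ∫⁻ y, {y | ENNReal.ofReal (s t) < f y}.indicator f y
        ≤ ∫⁻ y, ENNReal.ofReal (s t ^ (1 - p)) * f y ^ p := by
          refine lintegral_mono fun y => ?_
          by_cases hy : ENNReal.ofReal (s t) < f y
          · rw [indicator_of_mem (by exact hy), ← ENNReal.ofReal_rpow_of_pos hst]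
            have hfy0 : f y ≠ 0 := (bot_le.trans_lt hy).ne'
            rcases eq_or_ne (f y) ⊤ with hfy | hfy
            · rw [hfy, ENNReal.top_rpow_of_pos (by linarith), ENNReal.mul_top]
              · simp only [ne_eq, ENNReal.rpow_eq_zero_iff, not_or, not_and, not_lt]
                exact ⟨fun h => absurd h (by simpa using hst),
                  fun h => absurd h ENNReal.ofReal_ne_top⟩
            · calc f y = f y ^ (1 - p) * f y ^ p := by
                    rw [← ENNReal.rpow_add _ _ hfy0 hfy]; simp
                _ ≤ _ := by
                    refine mul_le_mul_left ?_ _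
                    rw [show 1 - p = -(p - 1) by ring, ENNReal.rpow_neg, ENNReal.rpow_neg]
                    exact ENNReal.inv_le_inv.2 (ENNReal.rpow_le_rpow hy.le hp1.le)
          · rw [indicator_of_notMem (by exact hy)]; exact zero_le
      _ = ENNReal.ofReal (s t ^ (1 - p)) * ∫⁻ y, f y ^ p := lintegral_const_mul _ (by fun_prop)
      _ ≤ _ := mul_le_of_le_one_right' hf1
  have hscale : ∫⁻ x, rieszPotential f x ^ q = ENNReal.ofReal (2 * A) ^ q *
      ∫⁻ x, ((ENNReal.ofReal (2 * A))⁻¹ * rieszPotential f x) ^ q := by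
    rw [← lintegral_const_mul _ (by have := measurable_rieszPotential hf; fun_prop)]
    refine lintegral_congr fun x => ?_
    rw [← ENNReal.mul_rpow_of_nonneg _ _ hq0.le, ← mul_assoc, ENNReal.mul_inv_cancel, one_mul]
    · simpa using hA0
    · exact ENNReal.ofReal_ne_top
  rw [hscale, show 20 / (2 - p) = 2 * A by rw [hA]; ring]
  refine mul_le_mul_right ?_ _
  rw [lintegral_rpow_eq_lintegral_measure_lt _
    ((measurable_rieszPotential hf).const_mul _) hq0]
  have hmsp : MeasurableSet {z : ℝ × (ℝ × ℝ) | ENNReal.ofReal (s z.1) < f z.2} :=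
    measurableSet_lt (by fun_prop) (by fun_prop)
  set B : ℝ := 25 * q / (A ^ 2 * m) with hB
  have hB0 : 0 < B := by positivity
  calc _ ≤ ∫⁻ t in Ioi (0 : ℝ), ∫⁻ y, ENNReal.ofReal (B * (m * t ^ (m - 1))) *
          {y | ENNReal.ofReal (s t) < f y}.indicator f y := by
        refine setLIntegral_mono' measurableSet_Ioi fun t (ht : 0 < t) => ?_
        have hms : MeasurableSet {y | ENNReal.ofReal (s t) < f y} :=
          measurableSet_lt measurable_const hf
        rw [lintegral_const_mul _ (hf.indicator hms)]
        refine (mul_le_mul_right (hlevel t ht) _).trans (le_of_eq ?_)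
        rw [← mul_assoc, ← ENNReal.ofReal_mul (by positivity)]
        congr 2
        have e1 : s t ^ (1 - p) = t ^ (-m) := by
          rw [hs, ← Real.rpow_mul ht.le]; congr 1; rw [hm]; field_simp; ring
        have e2 : q - 1 - 2 - m = m - 1 := by rw [hq, hm]; field_simp; ring
        rw [e1, ← e2, Real.rpow_sub ht (q - 1 - 2), Real.rpow_sub ht (q - 1),
          Real.rpow_neg ht.le, Real.rpow_two, hB]
        field_simp
    _ = ∫⁻ y, ENNReal.ofReal B * f y * ∫⁻ t in Ioi (0 : ℝ),
          {t : ℝ | ENNReal.ofReal t < f y ^ ((2 - p) / 2)}.indicator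
            (fun t => ENNReal.ofReal (m * t ^ (m - 1))) t := by
        rw [lintegral_lintegral_swap]
        · refine lintegral_congr fun y => ?_
          have hmt : MeasurableSet {t : ℝ | ENNReal.ofReal t < f y ^ ((2 - p) / 2)} :=
            measurableSet_lt (by fun_prop) measurable_const
          rw [← lintegral_const_mul _ (Measurable.indicator (by fun_prop) hmt)]
          refine setLIntegral_congr_fun measurableSet_Ioi fun t (ht : 0 < t) => ?_
          have hiff : ENNReal.ofReal (s t) < f y ↔ ENNReal.ofReal t < f y ^ ((2 - p) / 2) := by
            rw [← ENNReal.rpow_lt_rpow_iff (show 0 < (2 - p) / 2 by positivity),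
              ENNReal.ofReal_rpow_of_pos (Real.rpow_pos_of_pos ht _), ← Real.rpow_mul ht.le,
              show 2 / (2 - p) * ((2 - p) / 2) = 1 by field_simp, Real.rpow_one]
          by_cases hy : ENNReal.ofReal (s t) < f y
          · rw [indicator_of_mem (by exact hy), indicator_of_mem (by exact hiff.1 hy),
              ENNReal.ofReal_mul hB0.le]
            ring
          · rw [indicator_of_notMem (by exact hy),
              indicator_of_notMem (by exact fun h => hy (hiff.2 h))]
            simp
        · have : Measurable ({z : ℝ × (ℝ × ℝ) | ENNReal.ofReal (s z.1) < f z.2}.indicator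
            fun z => f z.2) := Measurable.indicator (by fun_prop) hmsp
          have h2 : Measurable fun z : ℝ × (ℝ × ℝ) => ENNReal.ofReal (B * (m * z.1 ^ (m - 1))) *
            {z : ℝ × (ℝ × ℝ) | ENNReal.ofReal (s z.1) < f z.2}.indicator (fun z => f z.2) z := by
            fun_prop
          exact h2.aemeasurable
    _ = ∫⁻ y, ENNReal.ofReal B * f y ^ p := by
        refine lintegral_congr fun y => ?_
        rw [lintegral_Ioi_indicator_rpow hm0, ← ENNReal.rpow_mul,
          show (2 - p) / 2 * m = p - 1 by rw [hm]; field_simp, mul_assoc]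
        congr 1
        nth_rewrite 1 [← ENNReal.rpow_one (f y)]
        rw [← ENNReal.rpow_add_of_nonneg _ _ one_pos.le hp1.le, add_sub_cancel]
    _ = ENNReal.ofReal B * ∫⁻ y, f y ^ p := lintegral_const_mul _ (by fun_prop)
    _ ≤ ENNReal.ofReal B := mul_le_of_le_one_right' hf1
    _ = _ := by
        congr 1
        rw [hB, hA, hm]
        field_simp
        norm_num

/-- The Hardy–Littlewood–Sobolev inequality for the fractional integral of order one in the
plane. -/
theorem exists_lintegral_rieszPotential_rpow_le {p q : ℝ} (hp : 1 < p) (hp2 : p < 2) (hq : 0 < q)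
    (hpq : 1 / p - 1 / q = 1 / 2) :
    ∃ C : ℝ≥0∞, C ≠ ⊤ ∧ ∀ f : ℝ × ℝ → ℝ≥0∞, AEMeasurable f →
      (∫⁻ x, rieszPotential f x ^ q) ^ (1 / q) ≤ C * (∫⁻ y, f y ^ p) ^ (1 / p) := by
  set D : ℝ≥0∞ := ENNReal.ofReal (20 / (2 - p)) ^ q *
    ENNReal.ofReal (q * (2 - p) ^ 3 / (8 * (p - 1))) + 1 with hD
  have hp0 : 0 < p := by linarith
  have hDtop : D ≠ ⊤ := by
    have := ENNReal.rpow_ne_top_of_nonneg hq.le (ENNReal.ofReal_ne_top (r := 20 / (2 - p)))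
    rw [hD]; finiteness
  have hD0 : D ≠ 0 := by rw [hD]; simp
  refine ⟨D ^ (1 / q), ENNReal.rpow_ne_top_of_nonneg (by positivity) hDtop, fun f hf => ?_⟩
  wlog hfm : Measurable f generalizing f
  · have h1 := this (hf.mk f) hf.measurable_mk.aemeasurable hf.measurable_mk
    have e1 : rieszPotential f = rieszPotential (hf.mk f) := by
      ext x
      exact lintegral_congr_ae (hf.ae_eq_mk.mono fun y hy => by simp only [hy])
    have e2 : ∫⁻ y, f y ^ p = ∫⁻ y, hf.mk f y ^ p :=
      lintegral_congr_ae (hf.ae_eq_mk.mono fun y hy => by simp only [hy])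
    rwa [e1, e2]
  set I := ∫⁻ y, f y ^ p with hI
  rcases eq_or_ne I 0 with h0 | h0
  · rw [hI, lintegral_eq_zero_iff (by fun_prop)] at h0
    have e1 : rieszPotential f = 0 := by
      ext x
      refine (lintegral_congr_ae (g := 0) (h0.mono fun y hy => ?_)).trans (by simp)
      have : f y = 0 := (ENNReal.rpow_eq_zero_iff_of_pos hp0).1 hy
      simp [this]
    rw [e1]
    simp [hq]
  rcases eq_or_ne I ⊤ with h1 | h1
  · rw [h1, ENNReal.top_rpow_of_pos (by positivity), ENNReal.mul_top]
    · exact le_top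
    · simp [hD0, hDtop]
  set J := I ^ (1 / p) with hJ
  have hJ0 : J ≠ 0 := by simp [hJ, h0, h1]
  have hJt : J ≠ ⊤ := ENNReal.rpow_ne_top_of_nonneg (by positivity) h1
  have h2 : ∫⁻ y, (J⁻¹ * f y) ^ p ≤ 1 := by
    simp_rw [ENNReal.mul_rpow_of_nonneg _ _ hp0.le]
    rw [lintegral_const_mul _ (by fun_prop), ENNReal.inv_rpow, hJ, ← ENNReal.rpow_mul,
      one_div_mul_cancel hp0.ne', ENNReal.rpow_one, ← hI, ENNReal.inv_mul_cancel h0 h1]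
  have h3 := lintegral_rieszPotential_rpow_le_of_le_one hp hp2 hpq (hfm.const_mul J⁻¹) h2
  have e3 : ∀ x, rieszPotential (fun y => J⁻¹ * f y) x = J⁻¹ * rieszPotential f x := by
    intro x
    unfold rieszPotential
    rw [← lintegral_const_mul _ (by fun_prop)]
    simp_rw [mul_assoc]
  simp_rw [e3, ENNReal.mul_rpow_of_nonneg _ _ hq.le] at h3
  rw [lintegral_const_mul _ (by have := measurable_rieszPotential hfm; fun_prop)] at h3
  have h4 := ENNReal.rpow_le_rpow (h3.trans (le_self_add : _ ≤ D))
    (show 0 ≤ 1 / q by positivity)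
  rw [ENNReal.mul_rpow_of_nonneg _ _ (by positivity), ← ENNReal.rpow_mul,
    mul_one_div_cancel hq.ne', ENNReal.rpow_one, mul_comm, ← div_eq_mul_inv,
    ENNReal.div_le_iff hJ0 hJt] at h4
  exact h4

end

open Set Filter Topology ComplexConjugate

/-! ### The plane as `ℂ` -/

/-- The identification of the plane with `ℂ`, as a real-linear map. -/
noncomputable def toComplex : ℝ × ℝ →L[ℝ] ℂ :=
  (Complex.equivRealProdCLM.symm : ℝ × ℝ →L[ℝ] ℂ)

theorem toComplex_apply (z : ℝ × ℝ) : toComplex z = z.1 + z.2 * Complex.I :=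
  Complex.equivRealProdCLM_symm_apply z

theorem sq_norm_toComplex (z : ℝ × ℝ) : ‖toComplex z‖ ^ 2 = z.1 ^ 2 + z.2 ^ 2 := by
  rw [toComplex_apply, ← Complex.normSq_eq_norm_sq, Complex.normSq_add_mul_I]

theorem toComplex_mul_conj (z : ℝ × ℝ) :
    conj (toComplex z) * toComplex z = ((z.1 ^ 2 + z.2 ^ 2 : ℝ) : ℂ) := by
  rw [Complex.conj_mul', ← sq_norm_toComplex, Complex.ofReal_pow]

theorem norm_le_norm_toComplex (z : ℝ × ℝ) : ‖z‖ ≤ ‖toComplex z‖ := by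
  have h := sq_norm_toComplex z
  rw [Prod.norm_def, Real.norm_eq_abs, Real.norm_eq_abs]
  exact max_le (abs_le_of_sq_le_sq (by nlinarith [sq_nonneg z.2]) (norm_nonneg _))
    (abs_le_of_sq_le_sq (by nlinarith [sq_nonneg z.1]) (norm_nonneg _))

theorem measurableSet_disc (z₀ : ℝ × ℝ) (r : ℝ) :
    MeasurableSet {z : ℝ × ℝ | ‖toComplex (z - z₀)‖ < r} :=
  (isOpen_lt (f := fun z : ℝ × ℝ => ‖toComplex (z - z₀)‖) (by fun_prop)
    continuous_const).measurableSet

/-! ### Calculus of `∂̄` -/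

theorem HasFDerivAt.dbar_eq {f : ℝ × ℝ → ℂ} {L : ℝ × ℝ →L[ℝ] ℂ} {z : ℝ × ℝ}
    (h : HasFDerivAt f L z) : dbar f z = (Complex.I * L (0, 1) + L (1, 0)) / 2 := by
  rw [dbar, h.fderiv]

theorem dbar_mul {f g : ℝ × ℝ → ℂ} {z : ℝ × ℝ} (hf : DifferentiableAt ℝ f z)
    (hg : DifferentiableAt ℝ g z) :
    dbar (fun ζ => f ζ * g ζ) z = dbar f z * g z + f z * dbar g z := by
  have h : HasFDerivAt (fun ζ => f ζ * g ζ) _ z := hf.hasFDerivAt.mul hg.hasFDerivAt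
  rw [h.dbar_eq, dbar, dbar]
  simp
  ring

theorem dbar_pow_eq_zero {f : ℝ × ℝ → ℂ} {z : ℝ × ℝ} (hf : DifferentiableAt ℝ f z)
    (h : dbar f z = 0) (n : ℕ) : dbar (fun ζ => f ζ ^ n) z = 0 := by
  induction n with
  | zero => simp [dbar]
  | succ n ih =>
    simp_rw [pow_succ]
    rw [dbar_mul (f := fun ζ => f ζ ^ n) (hf.pow n) hf, ih, h]
    simp

theorem dbar_comp_sub (f : ℝ × ℝ → ℂ) (a z : ℝ × ℝ) :
    dbar (fun ζ => f (ζ - a)) z = dbar f (z - a) := by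
  simp only [dbar, fderiv_comp_sub]

theorem dbar_comp_smul (f : ℝ × ℝ → ℂ) (a : ℝ) (z : ℝ × ℝ) :
    dbar (fun ζ => f (a • ζ)) z = a * dbar f (a • z) := by
  have h := fderiv_comp_smul (𝕜 := ℝ) (f := f) (x := z) a
  simp only [dbar, h]
  simp
  ring

theorem continuous_dbar {f : ℝ × ℝ → ℂ} (hf : ContDiff ℝ ∞ f) : Continuous (dbar f) := by
  have := hf.continuous_fderiv (by simp)
  unfold dbar
  fun_prop

theorem dbar_eq_zero_of_eventuallyEq_const {f : ℝ × ℝ → ℂ} {z : ℝ × ℝ} {c : ℂ}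
    (h : f =ᶠ[𝓝 z] fun _ => c) : dbar f z = 0 := by
  simp [dbar, h.fderiv_eq]

theorem support_dbar_subset (f : ℝ × ℝ → ℂ) : Function.support (dbar f) ⊆ tsupport f := by
  intro z hz
  by_contra hcon
  refine hz (dbar_eq_zero_of_eventuallyEq_const (c := 0) ?_)
  exact notMem_tsupport_iff_eventuallyEq.1 hcon

theorem HasCompactSupport.dbar {f : ℝ × ℝ → ℂ} (hf : HasCompactSupport f) :
    HasCompactSupport (dbar f) :=
  HasCompactSupport.of_support_subset_isCompact hf (support_dbar_subset f)

/-! ### The regularized Cauchy kernel -/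

/-- A smooth non-decreasing function which is `0` on `(-∞, 1/2]` and `1` on `[1, ∞)`. -/
noncomputable def smoothStep (s : ℝ) : ℝ := Real.smoothTransition (2 * s - 1)

theorem contDiff_smoothStep : ContDiff ℝ ∞ smoothStep :=
  Real.smoothTransition.contDiff.comp (by fun_prop)

theorem smoothStep_of_le {s : ℝ} (h : s ≤ 1 / 2) : smoothStep s = 0 :=
  Real.smoothTransition.zero_of_nonpos (by linarith)

theorem smoothStep_of_one_le {s : ℝ} (h : 1 ≤ s) : smoothStep s = 1 :=
  Real.smoothTransition.one_of_one_le (by linarith)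

theorem monotone_smoothStep : Monotone smoothStep :=
  Real.smoothTransition.monotone.comp fun _ _ h => by linarith

theorem deriv_smoothStep_of_one_lt {s : ℝ} (h : 1 < s) : deriv smoothStep s = 0 := by
  have : smoothStep =ᶠ[𝓝 s] fun _ => 1 := by
    filter_upwards [lt_mem_nhds h] with t ht using smoothStep_of_one_le ht.le
  rw [this.deriv_eq, deriv_const]

theorem exists_deriv_smoothStep_ne_zero : ∃ s : ℝ, 0 < s ∧ deriv smoothStep s ≠ 0 := by
  obtain ⟨s, hs, h⟩ := exists_deriv_eq_slope smoothStep (show (0 : ℝ) < 1 by norm_num)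
    contDiff_smoothStep.continuous.continuousOn
    (contDiff_smoothStep.differentiable (by simp)).differentiableOn
  refine ⟨s, hs.1, ?_⟩
  rw [h, smoothStep_of_one_le le_rfl, smoothStep_of_le (by norm_num)]
  norm_num

theorem contDiff_smoothStep_div : ContDiff ℝ ∞ fun s => smoothStep s / s := by
  rw [contDiff_iff_contDiffAt]
  intro s
  rcases lt_or_ge s (1 / 2) with h | h
  · have : (fun s => smoothStep s / s) =ᶠ[𝓝 s] fun _ => 0 := by
      filter_upwards [gt_mem_nhds h] with t ht
      rw [smoothStep_of_le ht.le, zero_div]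
    exact contDiffAt_const.congr_of_eventuallyEq this
  · exact contDiff_smoothStep.contDiffAt.div contDiffAt_id (by simp; linarith)

/-- A smooth regularization of the kernel `1 / z`, equal to it for `|z| ≥ δ`. It is written as
`conj z * h (|z| ^ 2)` with `h` smooth, which makes its smoothness at the origin apparent. -/
noncomputable def cauchyKernel (δ : ℝ) (z : ℝ × ℝ) : ℂ :=
  conj (toComplex z) *
    ((δ⁻¹ ^ 2 * (smoothStep (δ⁻¹ ^ 2 * (z.1 ^ 2 + z.2 ^ 2)) /
      (δ⁻¹ ^ 2 * (z.1 ^ 2 + z.2 ^ 2))) : ℝ) : ℂ)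

/-- The `∂̄`-derivative of `cauchyKernel δ`, see `dbar_cauchyKernel`: a non-negative bump at scale
`δ`, whose integral does not depend on `δ`. -/
noncomputable def cauchyMollifier (δ : ℝ) (z : ℝ × ℝ) : ℝ :=
  δ⁻¹ ^ 2 * deriv smoothStep (δ⁻¹ ^ 2 * (z.1 ^ 2 + z.2 ^ 2))

theorem contDiff_cauchyKernel (δ : ℝ) : ContDiff ℝ ∞ (cauchyKernel δ) := by
  unfold cauchyKernel
  refine ContDiff.mul ?_ ?_
  · exact (Complex.conjCLE.contDiff).comp toComplex.contDiff
  · refine Complex.ofRealCLM.contDiff.comp (contDiff_const.mul ?_)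
    exact contDiff_smoothStep_div.comp (f := fun z : ℝ × ℝ => δ⁻¹ ^ 2 * (z.1 ^ 2 + z.2 ^ 2))
      (by fun_prop)

theorem dbar_cauchyKernel {δ : ℝ} (hδ : 0 < δ) (z : ℝ × ℝ) :
    dbar (cauchyKernel δ) z = cauchyMollifier δ z := by
  set a : ℝ := δ⁻¹ ^ 2 with ha
  have ha0 : 0 < a := by positivity
  set s : ℝ := a * (z.1 ^ 2 + z.2 ^ 2) with hs
  set h : ℝ → ℝ := fun s => smoothStep s / s with hh
  have hd : HasDerivAt h (deriv h s) s :=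
    (contDiff_smoothStep_div.differentiable (by simp) s).hasDerivAt
  -- `H = s ↦ s * h s`, so `H' = h + s * h'`
  have hH : deriv smoothStep s = h s + s * deriv h s := by
    have h1 : smoothStep = fun s => s * h s := by
      ext t
      rcases eq_or_ne t 0 with rfl | ht
      · simp [smoothStep_of_le]
      · simp only [hh]; field_simp
    have h2 : HasDerivAt smoothStep (1 * h s + s * deriv h s) s := by
      rw [h1]; exact (hasDerivAt_id s).mul hd
    rw [h2.deriv, one_mul]
  have hN : HasFDerivAt (fun z : ℝ × ℝ => a * (z.1 ^ 2 + z.2 ^ 2))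
      (a • ((2 * z.1) • ContinuousLinearMap.fst ℝ ℝ ℝ
        + (2 * z.2) • ContinuousLinearMap.snd ℝ ℝ ℝ)) z := by
    refine HasFDerivAt.const_mul ?_ a
    have h1 : HasFDerivAt (fun z : ℝ × ℝ => z.1 ^ 2)
        ((2 * z.1) • ContinuousLinearMap.fst ℝ ℝ ℝ) z := by
      simpa using (hasFDerivAt_fst (𝕜 := ℝ) (p := z)).pow 2
    have h2 : HasFDerivAt (fun z : ℝ × ℝ => z.2 ^ 2)
        ((2 * z.2) • ContinuousLinearMap.snd ℝ ℝ ℝ) z := by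
      simpa using (hasFDerivAt_snd (𝕜 := ℝ) (p := z)).pow 2
    exact h1.add h2
  have hG0 : HasFDerivAt (h ∘ fun z : ℝ × ℝ => a * (z.1 ^ 2 + z.2 ^ 2)) _ z :=
    HasDerivAt.comp_hasFDerivAt z hd hN
  have hG : HasFDerivAt (fun z : ℝ × ℝ => a * h (a * (z.1 ^ 2 + z.2 ^ 2))) _ z :=
    hG0.const_mul a
  have hR : HasFDerivAt (fun z : ℝ × ℝ => ((a * h (a * (z.1 ^ 2 + z.2 ^ 2)) : ℝ) : ℂ)) _ z :=
    Complex.ofRealCLM.hasFDerivAt.comp z hG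
  have hC : HasFDerivAt (fun z : ℝ × ℝ => conj (toComplex z)) _ z :=
    (Complex.conjCLE : ℂ →L[ℝ] ℂ).hasFDerivAt.comp z toComplex.hasFDerivAt
  have hk : cauchyKernel δ = fun z => conj (toComplex z) *
      ((a * h (a * (z.1 ^ 2 + z.2 ^ 2)) : ℝ) : ℂ) := rfl
  rw [hk, dbar_mul hC.differentiableAt hR.differentiableAt, hC.dbar_eq, hR.dbar_eq]
  have e : ((a * deriv smoothStep s : ℝ) : ℂ) = a * h s +
      a * (conj (toComplex z) * toComplex z * a * deriv h s) := by
    rw [hH, toComplex_mul_conj, hs]; push_cast; ring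
  rw [cauchyMollifier, ← ha, ← hs, e]
  simp [toComplex_apply]
  ring

theorem cauchyKernel_mul_toComplex {δ : ℝ} (hδ : 0 < δ) (z : ℝ × ℝ) :
    cauchyKernel δ z * toComplex z = (smoothStep (δ⁻¹ ^ 2 * ‖toComplex z‖ ^ 2) : ℝ) := by
  rw [cauchyKernel, mul_right_comm, toComplex_mul_conj, sq_norm_toComplex, ← Complex.ofReal_mul]
  congr 1
  rcases eq_or_ne (z.1 ^ 2 + z.2 ^ 2) 0 with h | h
  · rw [h]; simp [smoothStep_of_le]
  · field_simp

theorem cauchyKernel_eq_inv {δ : ℝ} (hδ : 0 < δ) {z : ℝ × ℝ} (hz : δ ≤ ‖toComplex z‖) :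
    cauchyKernel δ z = (toComplex z)⁻¹ := by
  have h := cauchyKernel_mul_toComplex hδ z
  rw [smoothStep_of_one_le, Complex.ofReal_one] at h
  · exact eq_inv_of_mul_eq_one_left h
  · rw [← mul_pow, ← div_eq_inv_mul]
    exact one_le_pow₀ ((one_le_div hδ).2 hz)

theorem norm_cauchyKernel_le_inv {δ : ℝ} (hδ : 0 < δ) (z : ℝ × ℝ) :
    ‖cauchyKernel δ z‖ ≤ ‖toComplex z‖⁻¹ := by
  rcases eq_or_ne (toComplex z) 0 with h | h
  · simp [cauchyKernel, h]
  rw [← one_div, le_div_iff₀ (norm_pos_iff.2 h), ← norm_mul, cauchyKernel_mul_toComplex hδ,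
    Complex.norm_real, Real.norm_eq_abs,
    abs_of_nonneg (show 0 ≤ smoothStep _ from Real.smoothTransition.nonneg _)]
  exact Real.smoothTransition.le_one _

theorem enorm_cauchyKernel_le_inv {δ : ℝ} (hδ : 0 < δ) (z : ℝ × ℝ) :
    ‖cauchyKernel δ z‖ₑ ≤ ‖z‖ₑ⁻¹ := by
  rcases eq_or_ne z 0 with rfl | h
  · simp
  have hz : 0 < ‖z‖ := norm_pos_iff.2 h
  rw [← ofReal_norm, ← ofReal_norm, ← ENNReal.ofReal_inv_of_pos hz]
  exact ENNReal.ofReal_le_ofReal ((norm_cauchyKernel_le_inv hδ z).trans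
    (inv_anti₀ hz (norm_le_norm_toComplex z)))

theorem norm_cauchyKernel_le {δ : ℝ} (hδ : 0 < δ) (z : ℝ × ℝ) :
    ‖cauchyKernel δ z‖ ≤ (1 + 2 / δ) * (1 + ‖z‖)⁻¹ := by
  rcases le_or_gt (δ⁻¹ ^ 2 * ‖toComplex z‖ ^ 2) (1 / 2) with h | h
  · have : cauchyKernel δ z = 0 := by
      rw [cauchyKernel, ← sq_norm_toComplex, smoothStep_of_le h]; simp
    rw [this, norm_zero]; positivity
  · have h1 : δ / 2 ≤ ‖toComplex z‖ := by
      by_contra! hcon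
      have : δ⁻¹ * ‖toComplex z‖ < 1 / 2 := by
        rw [← div_eq_inv_mul, div_lt_iff₀ hδ]; linarith
      have h0 : 0 ≤ δ⁻¹ * ‖toComplex z‖ := by positivity
      nlinarith
    have h2 : 0 < ‖toComplex z‖ := by linarith
    refine (norm_cauchyKernel_le_inv hδ z).trans ?_
    rw [← div_eq_mul_inv, le_div_iff₀ (by positivity), inv_mul_le_iff₀ h2]
    have h3 : 1 ≤ ‖toComplex z‖ * (2 / δ) := by
      rw [mul_div_assoc', le_div_iff₀ hδ]; linarith
    linarith [norm_le_norm_toComplex z]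

theorem memLp_cauchyKernel {δ : ℝ} (hδ : 0 < δ) {r : ℝ} (hr : 2 < r) :
    MemLp (cauchyKernel δ) (ENNReal.ofReal r) := by
  have hr0 : 0 < r := by linarith
  have h1 : MemLp (fun z : ℝ × ℝ => (1 + ‖z‖)⁻¹) (ENNReal.ofReal r) := by
    have hm : AEStronglyMeasurable (fun z : ℝ × ℝ => (1 + ‖z‖)⁻¹) volume :=
      (Continuous.inv₀ (by fun_prop) fun z => by positivity).aestronglyMeasurable
    rw [← integrable_norm_rpow_iff hm (by simpa using hr0) (by simp)]
    rw [ENNReal.toReal_ofReal hr0.le]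
    refine (integrable_one_add_norm (E := ℝ × ℝ) (μ := volume) (r := r) (by simpa)).congr ?_
    filter_upwards with z
    rw [Real.norm_eq_abs, abs_of_pos (by positivity), Real.inv_rpow (by positivity),
      Real.rpow_neg (by positivity)]
  refine (h1.const_mul (1 + 2 / δ)).mono
    (contDiff_cauchyKernel δ).continuous.aestronglyMeasurable ?_
  filter_upwards with z
  refine (norm_cauchyKernel_le hδ z).trans (le_abs_self _)

theorem continuous_cauchyMollifier (δ : ℝ) : Continuous (cauchyMollifier δ) := by
  have := contDiff_smoothStep.continuous_deriv (by simp)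
  unfold cauchyMollifier
  fun_prop

theorem cauchyMollifier_nonneg (δ : ℝ) (z : ℝ × ℝ) : 0 ≤ cauchyMollifier δ z :=
  mul_nonneg (by positivity) monotone_smoothStep.deriv_nonneg

theorem cauchyMollifier_eq_zero {δ : ℝ} (hδ : 0 < δ) {z : ℝ × ℝ} (hz : δ < ‖toComplex z‖) :
    cauchyMollifier δ z = 0 := by
  rw [cauchyMollifier, deriv_smoothStep_of_one_lt, mul_zero]
  rw [← sq_norm_toComplex, ← mul_pow, ← div_eq_inv_mul]
  exact one_lt_pow₀ ((one_lt_div hδ).2 hz) two_ne_zero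

theorem support_cauchyMollifier_subset {δ : ℝ} (hδ : 0 < δ) :
    Function.support (cauchyMollifier δ) ⊆ Metric.closedBall 0 δ := by
  intro z hz
  rw [mem_closedBall_zero_iff]
  by_contra! h
  exact hz (cauchyMollifier_eq_zero hδ (h.trans_le (norm_le_norm_toComplex z)))

theorem hasCompactSupport_cauchyMollifier {δ : ℝ} (hδ : 0 < δ) :
    HasCompactSupport (cauchyMollifier δ) :=
  HasCompactSupport.of_support_subset_isCompact (isCompact_closedBall 0 δ)
    (support_cauchyMollifier_subset hδ)

theorem cauchyMollifier_eq (δ : ℝ) (z : ℝ × ℝ) :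
    cauchyMollifier δ z = δ⁻¹ ^ 2 * cauchyMollifier 1 (δ⁻¹ • z) := by
  simp only [cauchyMollifier, inv_one, one_pow, one_mul, Prod.smul_fst, Prod.smul_snd, smul_eq_mul]
  ring_nf

theorem integral_cauchyMollifier {δ : ℝ} (hδ : 0 < δ) :
    ∫ z, cauchyMollifier δ z = ∫ z, cauchyMollifier 1 z := by
  simp_rw [cauchyMollifier_eq δ]
  rw [integral_const_mul, Measure.integral_comp_smul]
  simp only [Module.finrank_prod, Module.finrank_self, smul_eq_mul]
  rw [abs_of_pos (by positivity)]
  rw [← mul_assoc, one_add_one_eq_two, mul_inv_cancel₀ (by positivity), one_mul]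

theorem integral_cauchyMollifier_one_pos : 0 < ∫ z, cauchyMollifier 1 z := by
  obtain ⟨s, hs, h⟩ := exists_deriv_smoothStep_ne_zero
  refine (continuous_cauchyMollifier 1).integral_pos_of_hasCompactSupport_nonneg_nonzero
    (hasCompactSupport_cauchyMollifier one_pos) (cauchyMollifier_nonneg 1) (x := (√s, 0)) ?_
  simpa [cauchyMollifier, Real.sq_sqrt hs.le] using h

theorem exists_cauchyMollifier_le :
    ∃ M : ℝ, 0 < M ∧ ∀ δ : ℝ, ∀ z, cauchyMollifier δ z ≤ δ⁻¹ ^ 2 * M := by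
  obtain ⟨M, hM⟩ := (continuous_cauchyMollifier 1).bounded_above_of_compact_support
    (hasCompactSupport_cauchyMollifier one_pos)
  refine ⟨max M 1, by positivity, fun δ z => ?_⟩
  rw [cauchyMollifier_eq]
  gcongr
  exact (le_abs_self _).trans ((hM _).trans (le_max_left _ _))

/-! ### Pointwise bound by the fractional integral of `∂̄` -/

/-- Product rule for the weak `∂̄`-derivative, for a smooth factor which is holomorphic wherever `u`
does not vanish. -/
theorem HasWeakDbar.continuous_mul {u w m : ℝ × ℝ → ℂ} (h : HasWeakDbar u w)
    (hm : ContDiff ℝ ∞ m) (hum : ∀ᵐ z, u z * dbar m z = 0) :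
    HasWeakDbar (fun z => m z * u z) (fun z => m z * w z) where
  locallyIntegrable := h.locallyIntegrable.continuous_mul hm.continuous
  locallyIntegrable_deriv := h.locallyIntegrable_deriv.continuous_mul hm.continuous
  integral_eq φ hφ hφc := by
    have h1 := h.integral_eq (fun z => m z * φ z) (hm.mul hφ) hφc.mul_left
    have e1 : ∫ z, u z * dbar (fun z => m z * φ z) z = ∫ z, m z * u z * dbar φ z := by
      refine integral_congr_ae (hum.mono fun z hz => ?_)
      simp only
      rw [dbar_mul (hm.differentiable (by simp) z) (hφ.differentiable (by simp) z), mul_add,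
        ← mul_assoc, hz, zero_mul, zero_add]
      ring
    rw [← e1, h1]
    congr 2 with z
    ring

/-- The smooth function `cauchyKernel δ (· - z)` may be used as a test function although its
support is not compact: `g` is in `L ^ p` with `p < 2`, and the kernel is in the dual space. -/
theorem integral_mul_cauchyMollifier {p : ℝ} (hp : 1 < p) (hp2 : p < 2) {g G : ℝ × ℝ → ℂ}
    (h : HasWeakDbar g G) (hg : MemLp g (ENNReal.ofReal p)) (hG : Integrable G) {δ : ℝ}
    (hδ : 0 < δ) (z : ℝ × ℝ) :
    ∫ ζ, g ζ * (cauchyMollifier δ (ζ - z) : ℂ) = -∫ ζ, G ζ * cauchyKernel δ (ζ - z) := by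
  let χ : ContDiffBump (0 : ℝ × ℝ) := ⟨1, 2, one_pos, one_lt_two⟩
  set X : ℝ × ℝ → ℂ := fun y => (χ y : ℂ) with hX
  have hXs : ContDiff ℝ ∞ X := Complex.ofRealCLM.contDiff.comp χ.contDiff
  have hXc : HasCompactSupport X := χ.hasCompactSupport.comp_left Complex.ofReal_zero
  have hX1 : ∀ y, ‖X y‖ ≤ 1 := fun y => by
    rw [hX, Complex.norm_real, Real.norm_eq_abs, abs_of_nonneg χ.nonneg]
    exact χ.le_one
  have hX0 : X 0 = 1 := by
    rw [hX]
    simp only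
    rw [χ.one_of_mem_closedBall (Metric.mem_closedBall_self χ.rIn_pos.le), Complex.ofReal_one]
  obtain ⟨M, hM⟩ := (continuous_dbar hXs).bounded_above_of_compact_support hXc.dbar
  have hM0 : 0 ≤ M := (norm_nonneg _).trans (hM 0)
  set a : ℕ → ℝ := fun n => 1 / ((n : ℝ) + 1) with ha
  have ha0 : ∀ n, 0 < a n := fun n => Nat.one_div_pos_of_nat
  have ha1 : ∀ n, a n ≤ 1 := fun n => by
    rw [ha]; simp only; rw [div_le_one (by positivity)]; linarith [n.cast_nonneg (α := ℝ)]
  have hat : Tendsto a atTop (𝓝 0) := tendsto_one_div_add_atTop_nhds_zero_nat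
  have hsm : ∀ y : ℝ × ℝ, Tendsto (fun n => a n • y) atTop (𝓝 0) := fun y => by
    simpa using hat.smul_const y
  have hXt : ∀ y, Tendsto (fun n => X (a n • y)) atTop (𝓝 1) := fun y => by
    rw [← hX0]; exact (hXs.continuous.tendsto 0).comp (hsm y)
  have hk := contDiff_cauchyKernel δ
  -- the kernel, cut off at distance of order `n`
  set Φ : ℕ → ℝ × ℝ → ℂ := fun n y => cauchyKernel δ y * X (a n • y) with hΦ
  have hXn : ∀ n, ContDiff ℝ ∞ fun y => X (a n • y) := fun n => hXs.comp (contDiff_const_smul _)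
  have hΦs : ∀ n, ContDiff ℝ ∞ (Φ n) := fun n => hk.mul (hXn n)
  have hΦc : ∀ n, HasCompactSupport (Φ n) := fun n =>
    (hXc.comp_smul (ha0 n).ne').mul_left
  have hΦd : ∀ n y, dbar (Φ n) y = cauchyMollifier δ y * X (a n • y)
      + cauchyKernel δ y * (a n * dbar X (a n • y)) := fun n y => by
    rw [hΦ, dbar_mul (hk.differentiable (by simp) y) ((hXn n).differentiable (by simp) y),
      dbar_cauchyKernel hδ, dbar_comp_smul]
  have hmain : ∀ n, ∫ ζ, g ζ * dbar (Φ n) (ζ - z) = -∫ ζ, G ζ * Φ n (ζ - z) := fun n => by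
    have h1 := h.integral_eq (fun ζ => Φ n (ζ - z)) ((hΦs n).comp (contDiff_id.sub contDiff_const))
      ((hΦc n).comp_homeomorph (Homeomorph.subRight z))
    simpa only [dbar_comp_sub] using h1
  set r : ℝ := p / (p - 1) with hr
  have hp1 : 0 < p - 1 := by linarith
  have hr2 : 2 < r := by rw [hr, lt_div_iff₀ hp1]; linarith
  have hconj : ENNReal.HolderConjugate (ENNReal.ofReal p) (ENNReal.ofReal r) := by
    have := Real.HolderConjugate.conjExponent hp
    exact this.ennrealOfReal
  have hkL : MemLp (fun ζ => cauchyKernel δ (ζ - z)) (ENNReal.ofReal r) :=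
    (memLp_cauchyKernel hδ hr2).comp_measurePreserving (measurePreserving_sub_right volume z)
  have hPL : MemLp (fun ζ => (cauchyMollifier δ (ζ - z) : ℂ)) (ENNReal.ofReal r) := by
    have h1 : MemLp (cauchyMollifier δ) (ENNReal.ofReal r) :=
      (continuous_cauchyMollifier δ).memLp_of_hasCompactSupport
        (hasCompactSupport_cauchyMollifier hδ)
    exact (h1.comp_measurePreserving (measurePreserving_sub_right volume z)).ofReal
  have hgk := hg.integrable_mul hkL
  have hgP := hg.integrable_mul hPL
  have L1 : Tendsto (fun n => ∫ ζ, g ζ * dbar (Φ n) (ζ - z)) atTop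
      (𝓝 (∫ ζ, g ζ * (cauchyMollifier δ (ζ - z) : ℂ))) := by
    refine tendsto_integral_of_dominated_convergence
      (fun ζ => ‖g ζ * (cauchyMollifier δ (ζ - z) : ℂ)‖ + M * ‖g ζ * cauchyKernel δ (ζ - z)‖)
      (fun n => ?_) (hgP.norm.add (hgk.norm.const_mul M)) (fun n => ?_) ?_
    · exact hg.1.mul ((continuous_dbar (hΦs n)).comp
        (continuous_id.sub continuous_const)).aestronglyMeasurable
    · filter_upwards with ζ
      rw [hΦd, mul_add]
      refine (norm_add_le _ _).trans (add_le_add ?_ ?_)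
      · rw [← mul_assoc, norm_mul]
        exact mul_le_of_le_one_right (norm_nonneg _) (hX1 _)
      · rw [← mul_assoc, norm_mul, mul_comm M]
        refine mul_le_mul_of_nonneg_left ?_ (norm_nonneg _)
        rw [norm_mul, Complex.norm_real, Real.norm_eq_abs, abs_of_pos (ha0 n)]
        exact (mul_le_of_le_one_left (norm_nonneg _) (ha1 n)).trans (hM _)
    · filter_upwards with ζ
      refine Tendsto.const_mul _ ?_
      simp_rw [hΦd]
      have t1 := (hXt (ζ - z)).const_mul (cauchyMollifier δ (ζ - z) : ℂ)
      have t2 : Tendsto (fun n => (a n : ℂ) * dbar X (a n • (ζ - z))) atTop (𝓝 (0 * dbar X 0)) := by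
        refine Tendsto.mul ?_ (((continuous_dbar hXs).tendsto 0).comp (hsm _))
        exact (Complex.continuous_ofReal.tendsto' 0 0 Complex.ofReal_zero).comp hat
      simpa using t1.add (t2.const_mul (cauchyKernel δ (ζ - z)))
  have hkb : ∀ y, ‖cauchyKernel δ y‖ ≤ 1 + 2 / δ := fun y =>
    (norm_cauchyKernel_le hδ y).trans (mul_le_of_le_one_right (by positivity)
      (inv_le_one_of_one_le₀ (by linarith [norm_nonneg y])))
  have L2 : Tendsto (fun n => ∫ ζ, G ζ * Φ n (ζ - z)) atTop
      (𝓝 (∫ ζ, G ζ * cauchyKernel δ (ζ - z))) := by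
    refine tendsto_integral_of_dominated_convergence (fun ζ => ‖G ζ‖ * (1 + 2 / δ))
      (fun n => ?_) (hG.norm.mul_const _) (fun n => ?_) ?_
    · exact hG.1.mul ((hΦs n).continuous.comp
        (continuous_id.sub continuous_const)).aestronglyMeasurable
    · filter_upwards with ζ
      rw [norm_mul]
      refine mul_le_mul_of_nonneg_left ?_ (norm_nonneg _)
      rw [hΦ, norm_mul]
      exact (mul_le_of_le_one_right (norm_nonneg _) (hX1 _)).trans (hkb _)
    · filter_upwards with ζ
      refine Tendsto.const_mul _ ?_
      simpa using (hXt (ζ - z)).const_mul (cauchyKernel δ (ζ - z))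
  simp_rw [hmain] at L1
  exact tendsto_nhds_unique L1 L2.neg

/-- The Cauchy–Pompeiu representation of `g`, as an inequality: let `δ → 0` in
`integral_mul_cauchyMollifier` and use the Lebesgue differentiation theorem. -/
theorem ae_enorm_le_rieszPotential {p : ℝ} (hp : 1 < p) (hp2 : p < 2) {g G : ℝ × ℝ → ℂ}
    (h : HasWeakDbar g G) (hg : MemLp g (ENNReal.ofReal p)) (hG : Integrable G) :
    ∀ᵐ z, ‖g z‖ₑ ≤ ENNReal.ofReal (∫ y, cauchyMollifier 1 y)⁻¹ *
      rieszPotential (fun ζ => ‖G ζ‖ₑ) z := by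
  set c : ℝ := ∫ y, cauchyMollifier 1 y with hc
  have hc0 : 0 < c := integral_cauchyMollifier_one_pos
  obtain ⟨M, hM0, hM⟩ := exists_cauchyMollifier_le
  filter_upwards [(Besicovitch.vitaliFamily volume).ae_tendsto_average_norm_sub
    h.locallyIntegrable] with z hz
  have hz' := hz.comp (Besicovitch.tendsto_filterAt volume z)
  have hlim : Tendsto (fun δ : ℝ => ∫ ζ, (c⁻¹ * cauchyMollifier δ (ζ - z)) • g ζ) (𝓝[>] 0)
      (𝓝 (g z)) := by
    refine tendsto_integral_smul_of_tendsto_average_norm_sub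
      (c⁻¹ * M * volume.real (Metric.ball (0 : ℝ × ℝ) 1)) hz' ?_ ?_ ?_ ?_
    · filter_upwards with δ using h.locallyIntegrable.integrableOn_isCompact
        (isCompact_closedBall _ _)
    · refine tendsto_const_nhds.congr' ?_
      filter_upwards [self_mem_nhdsWithin] with δ (hδ : 0 < δ)
      rw [integral_const_mul, integral_sub_right_eq_self (fun y => cauchyMollifier δ y) z,
        integral_cauchyMollifier hδ, inv_mul_cancel₀ hc0.ne']
    · filter_upwards [self_mem_nhdsWithin] with δ (hδ : 0 < δ)
      intro ζ hζ
      have h1 : cauchyMollifier δ (ζ - z) ≠ 0 := fun h0 => hζ (by simp [h0])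
      have h2 := support_cauchyMollifier_subset hδ h1
      rwa [mem_closedBall_zero_iff, ← dist_eq_norm] at h2
    · filter_upwards [self_mem_nhdsWithin] with δ (hδ : 0 < δ) ζ
      rw [abs_of_nonneg (mul_nonneg (inv_pos.2 hc0).le (cauchyMollifier_nonneg _ _)),
        Measure.addHaar_real_closedBall _ _ hδ.le]
      have hb : 0 < volume.real (Metric.ball (0 : ℝ × ℝ) 1) :=
        ENNReal.toReal_pos (Metric.measure_ball_pos _ _ one_pos).ne' measure_ball_lt_top.ne
      rw [mul_div_mul_right _ _ hb.ne']
      refine (mul_le_mul_of_nonneg_left (hM δ _) (inv_pos.2 hc0).le).trans (le_of_eq ?_)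
      simp
      field_simp
  refine le_of_tendsto hlim.enorm ?_
  filter_upwards [self_mem_nhdsWithin] with δ (hδ : 0 < δ)
  have e1 : ∫ ζ, (c⁻¹ * cauchyMollifier δ (ζ - z)) • g ζ =
      ((c⁻¹ : ℝ) : ℂ) * ∫ ζ, g ζ * (cauchyMollifier δ (ζ - z) : ℂ) := by
    rw [← integral_const_mul]
    congr 1 with ζ
    rw [Complex.real_smul]
    push_cast
    ring
  rw [e1, enorm_mul, integral_mul_cauchyMollifier hp hp2 h hg hG hδ, enorm_neg, ← ofReal_norm,
    Complex.norm_real, Real.norm_eq_abs, abs_of_pos (inv_pos.2 hc0)]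
  refine mul_le_mul_right ((enorm_integral_le_lintegral_enorm _).trans ?_) _
  refine lintegral_mono fun ζ => ?_
  rw [enorm_mul, enorm_sub_rev z]
  exact mul_le_mul_right (enorm_cauchyKernel_le_inv hδ _) _

/-! ### The Carleman estimate and unique continuation -/

/-- Sobolev inequality for `∂̄`: `‖g‖_q ≤ A ‖∂̄ g‖_p`. -/
theorem exists_eLpNorm_le_of_hasWeakDbar {p q : ℝ} (hp : 1 < p) (hp2 : p < 2) (hq : 0 < q)
    (hpq : 1 / p - 1 / q = 1 / 2) :
    ∃ A : ENNReal, A ≠ ⊤ ∧ ∀ g G : ℝ × ℝ → ℂ, HasWeakDbar g G → MemLp g (ENNReal.ofReal p) →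
      Integrable G → eLpNorm g (ENNReal.ofReal q) ≤ A * eLpNorm G (ENNReal.ofReal p) := by
  obtain ⟨C, hC, h⟩ := exists_lintegral_rieszPotential_rpow_le hp hp2 hq hpq
  have hp0 : 0 < p := by linarith
  set a : ENNReal := ENNReal.ofReal (∫ y, cauchyMollifier 1 y)⁻¹ with ha
  have hat : a ≠ ⊤ := ENNReal.ofReal_ne_top
  refine ⟨a * C, ENNReal.mul_ne_top hat hC, fun g G hgG hg hG => ?_⟩
  have hb := ae_enorm_le_rieszPotential hp hp2 hgG hg hG
  rw [eLpNorm_eq_lintegral_rpow_enorm_toReal (by simpa using hq) ENNReal.ofReal_ne_top,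
    eLpNorm_eq_lintegral_rpow_enorm_toReal (by simpa using hp0) ENNReal.ofReal_ne_top,
    ENNReal.toReal_ofReal hq.le, ENNReal.toReal_ofReal hp0.le]
  calc (∫⁻ z, ‖g z‖ₑ ^ q) ^ (1 / q)
      ≤ (∫⁻ z, a ^ q * rieszPotential (fun ζ => ‖G ζ‖ₑ) z ^ q) ^ (1 / q) := by
        refine ENNReal.rpow_le_rpow (lintegral_mono_ae (hb.mono fun z hz => ?_)) (by positivity)
        rw [← ENNReal.mul_rpow_of_nonneg _ _ hq.le]
        exact ENNReal.rpow_le_rpow hz hq.le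
    _ = a * (∫⁻ z, rieszPotential (fun ζ => ‖G ζ‖ₑ) z ^ q) ^ (1 / q) := by
        rw [lintegral_const_mul' _ _ (ENNReal.rpow_ne_top_of_nonneg hq.le hat),
          ENNReal.mul_rpow_of_nonneg _ _ (by positivity), ← ENNReal.rpow_mul,
          mul_one_div_cancel hq.ne', ENNReal.rpow_one]
    _ ≤ _ := by
        rw [mul_assoc]
        exact mul_le_mul_right (h _ hG.1.enorm) _

theorem memLp_two_of_memLp {α : Type*} [MeasurableSpace α] {μ : Measure α} {u : α → ℂ} {p q : ℝ}
    (hp : 0 < p) (hp2 : p ≤ 2) (hq : 2 ≤ q) (hup : MemLp u (ENNReal.ofReal p) μ)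
    (huq : MemLp u (ENNReal.ofReal q) μ) : MemLp u 2 μ := by
  have hq0 : 0 < q := by linarith
  have h1 := hup.integrable_norm_rpow (by simpa using hp) ENNReal.ofReal_ne_top
  have h2 := huq.integrable_norm_rpow (by simpa using hq0) ENNReal.ofReal_ne_top
  rw [ENNReal.toReal_ofReal hp.le] at h1
  rw [ENNReal.toReal_ofReal hq0.le] at h2
  rw [memLp_two_iff_integrable_sq_norm hup.1]
  refine (h1.add h2).mono (hup.1.norm.pow 2) (.of_forall fun x => ?_)
  have e1 : 0 ≤ ‖u x‖ ^ p := by positivity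
  have e2 : 0 ≤ ‖u x‖ ^ q := by positivity
  rw [Pi.add_apply, Real.norm_of_nonneg (by positivity), Real.norm_of_nonneg (by positivity),
    ← Real.rpow_two]
  rcases le_total ‖u x‖ 1 with h | h
  · have := Real.rpow_le_rpow_of_exponent_ge' (norm_nonneg (u x)) h hp.le hp2
    linarith
  · have := Real.rpow_le_rpow_of_exponent_le h hq
    linarith

theorem holderTriple_two_ofReal {p q : ℝ} (hp0 : 0 < p) (hq0 : 0 < q)
    (hpq : 1 / p - 1 / q = 1 / 2) :
    ENNReal.HolderTriple 2 (ENNReal.ofReal q) (ENNReal.ofReal p) := by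
  constructor
  rw [← ENNReal.ofReal_inv_of_pos hq0, ← ENNReal.ofReal_inv_of_pos hp0,
    show (2⁻¹ : ENNReal) = ENNReal.ofReal 2⁻¹ by
      rw [ENNReal.ofReal_inv_of_pos two_pos, ENNReal.ofReal_ofNat],
    ← ENNReal.ofReal_add (by positivity) (by positivity)]
  congr 1
  simp only [one_div] at hpq
  linarith

theorem eLpNorm_mul_le_indicator_add_indicator_compl {α : Type*} [MeasureSpace α]
    {p q r : ENNReal} [ENNReal.HolderTriple p q r] (hr : 1 ≤ r) {f g : α → ℂ}
    (hf : AEStronglyMeasurable f) (hg : AEStronglyMeasurable g) {s : Set α}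
    (hs : MeasurableSet s) :
    eLpNorm (fun x => f x * g x) r ≤ eLpNorm (s.indicator f) p * eLpNorm g q +
      eLpNorm (sᶜ.indicator fun x => f x * g x) r := by
  have e : (fun x => f x * g x) = s.indicator f • g + sᶜ.indicator fun x => f x * g x := by
    ext x
    by_cases hx : x ∈ s <;> simp [hx]
  nth_rewrite 1 [e]
  have hsf := hf.indicator hs
  exact (eLpNorm_add_le (hsf.smul hg) ((hf.mul hg).indicator hs.compl) hr).trans
    (add_le_add_left (eLpNorm_smul_le_mul_eLpNorm hg hsf) _)

/-- The Carleman estimate. If `u` vanishes on the disc of radius `ε` around `z₀`, then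
`cauchyKernel ε (z - z₀) ^ n * u z` is `u z / (z - z₀) ^ n`; this weight commutes with `∂̄`, so
the constant of the Sobolev inequality does not depend on `n`. When `V` is small in `L ^ 2` of the
disc of radius `ρ`, the contribution of that disc is absorbed by the left-hand side. -/
theorem exists_eLpNorm_cauchyKernel_pow_mul_le {p q : ℝ} (hp : 1 < p) (hp2 : p < 2) (hq : 2 < q)
    (hpq : 1 / p - 1 / q = 1 / 2) :
    ∃ η : ℝ, 0 < η ∧ ∃ K : ENNReal, K ≠ ⊤ ∧
      ∀ u w V : ℝ × ℝ → ℂ, HasWeakDbar u w → MemLp u (ENNReal.ofReal p) →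
      MemLp u (ENNReal.ofReal q) → MemLp V 2 → (∀ᵐ z, ‖w z‖ ≤ ‖V z * u z‖) →
      ∀ (z₀ : ℝ × ℝ) (ρ ε : ℝ), 0 < ρ → 0 < ε →
      eLpNorm ({z | ‖toComplex (z - z₀)‖ < ρ}.indicator V) 2 ≤ ENNReal.ofReal η →
      (∀ᵐ z, ‖toComplex (z - z₀)‖ ≤ ε → u z = 0) → ∀ n : ℕ,
      eLpNorm (fun z => cauchyKernel ε (z - z₀) ^ n * u z) (ENNReal.ofReal q) ≤
        K * (ENNReal.ofReal (ρ⁻¹ ^ n) * eLpNorm (fun z => V z * u z) (ENNReal.ofReal p)) := by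
  have hp0 : 0 < p := by linarith
  have hq0 : 0 < q := by linarith
  obtain ⟨A, hA, hmain⟩ := exists_eLpNorm_le_of_hasWeakDbar hp hp2 hq0 hpq
  refine ⟨(2 * (A.toReal + 1))⁻¹, by positivity, 2 * A, ENNReal.mul_ne_top (by simp) hA, ?_⟩
  intro u w V huw hup huq hV hw z₀ ρ ε hρ hε hVη hvan n
  set η : ENNReal := ENNReal.ofReal (2 * (A.toReal + 1))⁻¹ with hη
  have hAη : A * η ≤ 2⁻¹ := by
    rw [hη, ← ENNReal.ofReal_toReal hA, ← ENNReal.ofReal_mul ENNReal.toReal_nonneg,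
      ENNReal.toReal_ofReal ENNReal.toReal_nonneg,
      show (2⁻¹ : ENNReal) = ENNReal.ofReal 2⁻¹ by
        rw [ENNReal.ofReal_inv_of_pos two_pos, ENNReal.ofReal_ofNat]]
    have := A.toReal_nonneg
    refine ENNReal.ofReal_le_ofReal ?_
    rw [← div_eq_mul_inv, div_le_iff₀ (by positivity)]
    linarith
  have hu2 := memLp_two_of_memLp hp0 hp2.le hq.le hup huq
  have := holderTriple_two_ofReal hp0 hq0 hpq
  have hVuL1 : Integrable (fun z => V z * u z) := hV.integrable_mul hu2
  have hVuLp : MemLp (fun z => V z * u z) (ENNReal.ofReal p) := huq.mul hV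
  have hwL1 : Integrable w := hVuL1.mono huw.locallyIntegrable_deriv.aestronglyMeasurable hw
  set S : ENNReal := eLpNorm (fun z => V z * u z) (ENNReal.ofReal p) volume with hS
  set k : ℝ × ℝ → ℂ := fun z => cauchyKernel ε (z - z₀) with hk
  have hks : ContDiff ℝ ∞ k := (contDiff_cauchyKernel ε).comp (contDiff_id.sub contDiff_const)
  have hkb : ∀ z, ‖k z‖ ≤ 1 + 2 / ε := fun z =>
    (norm_cauchyKernel_le hε _).trans (mul_le_of_le_one_right (by positivity)
      (inv_le_one_of_one_le₀ (by linarith [norm_nonneg (z - z₀)])))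
  set D : Set (ℝ × ℝ) := {z | ‖toComplex (z - z₀)‖ < ρ} with hD
  have hDm : MeasurableSet D := measurableSet_disc z₀ ρ
  have hkn : ContDiff ℝ ∞ fun z => k z ^ n := hks.pow n
  have hbd : ∀ f : ℝ × ℝ → ℂ, ∀ z, ‖k z ^ n * f z‖ ≤ (1 + 2 / ε) ^ n * ‖f z‖ := fun f z => by
    rw [norm_mul, norm_pow]
    exact mul_le_mul_of_nonneg_right (pow_le_pow_left₀ (norm_nonneg _) (hkb z) n) (norm_nonneg _)
  have hmem : ∀ {f : ℝ × ℝ → ℂ} {r : ENNReal}, MemLp f r → MemLp (fun z => k z ^ n * f z) r :=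
    fun {f r} hf => hf.of_le_mul (hkn.continuous.aestronglyMeasurable.mul hf.1)
      (.of_forall (hbd f))
  have hweak : HasWeakDbar (fun z => k z ^ n * u z) (fun z => k z ^ n * w z) := by
    refine huw.continuous_mul hkn (hvan.mono fun z hz => ?_)
    rcases le_or_gt ‖toComplex (z - z₀)‖ ε with h | h
    · rw [hz h, zero_mul]
    · rw [dbar_pow_eq_zero (hks.differentiable (by simp) z), mul_zero]
      rw [hk, dbar_comp_sub, dbar_cauchyKernel hε, cauchyMollifier_eq_zero hε h,
        Complex.ofReal_zero]
  have h1 := hmain _ _ hweak (hmem hup)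
    (memLp_one_iff_integrable.1 (hmem (memLp_one_iff_integrable.2 hwL1)))
  set N := eLpNorm (fun z => k z ^ n * u z) (ENNReal.ofReal q) volume with hNdef
  have hNt : N ≠ ⊤ := (hmem huq).2.ne
  have hsplit : eLpNorm (fun z => k z ^ n * w z) (ENNReal.ofReal p) ≤
      η * N + ENNReal.ofReal (ρ⁻¹ ^ n) * S := by
    calc eLpNorm (fun z => k z ^ n * w z) (ENNReal.ofReal p) volume
        ≤ eLpNorm (fun z => V z * (k z ^ n * u z)) (ENNReal.ofReal p) volume := by
          refine eLpNorm_mono_ae (hw.mono fun z hz => ?_)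
          rw [mul_left_comm, norm_mul, norm_mul (k z ^ n)]
          exact mul_le_mul_of_nonneg_left hz (norm_nonneg _)
      _ ≤ eLpNorm (D.indicator V) 2 volume * N +
            eLpNorm (Dᶜ.indicator fun z => V z * (k z ^ n * u z)) (ENNReal.ofReal p) volume :=
          eLpNorm_mul_le_indicator_add_indicator_compl (p := 2) (q := ENNReal.ofReal q) (f := V)
            (g := fun z => k z ^ n * u z) (by simpa using hp.le) hV.1 (hmem huq).1 hDm
      _ ≤ η * N + ENNReal.ofReal (ρ⁻¹ ^ n) * S := by
          refine add_le_add (mul_le_mul_left hVη _) ?_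
          refine eLpNorm_le_mul_eLpNorm_of_ae_le_mul (g := fun z => V z * u z)
            (.of_forall fun z => ?_) _
          by_cases hzD : z ∈ D
          · rw [indicator_of_notMem (by simpa using hzD), norm_zero]
            positivity
          · rw [indicator_of_mem (by exact hzD), mul_left_comm, norm_mul, norm_pow]
            refine mul_le_mul_of_nonneg_right (pow_le_pow_left₀ (norm_nonneg _) ?_ n)
              (norm_nonneg _)
            refine (norm_cauchyKernel_le_inv hε _).trans (inv_anti₀ hρ ?_)
            exact not_lt.1 hzD
  have h2 : N ≤ 2⁻¹ * N + A * (ENNReal.ofReal (ρ⁻¹ ^ n) * S) := by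
    refine (h1.trans (mul_le_mul_right hsplit _)).trans ?_
    rw [mul_add, ← mul_assoc]
    exact add_le_add_left (mul_le_mul_left hAη N) _
  have h3 : N = 2⁻¹ * N + 2⁻¹ * N := by
    rw [← add_mul, ENNReal.inv_two_add_inv_two, one_mul]
  have hht : 2⁻¹ * N ≠ ⊤ := ENNReal.mul_ne_top (by simp) hNt
  nth_rewrite 1 [h3] at h2
  have h4 := (ENNReal.add_le_add_iff_left hht).1 h2
  rwa [ENNReal.inv_mul_le_iff (by simp) (by simp), ← mul_assoc] at h4

/-- Local unique continuation: vanishing near `z₀` propagates to the disc of radius `ρ / 2`, as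
soon as `V` is small in `L ^ 2` of the disc of radius `ρ`. On the smaller disc the weight
`|z - z₀| ^ (-n)` is at least `2 ^ n` times its bound `ρ ^ (-n)` outside the larger one; let
`n → ∞`. -/
theorem exists_ae_eq_zero_of_ae_eq_zero_near {p q : ℝ} (hp : 1 < p) (hp2 : p < 2) (hq : 2 < q)
    (hpq : 1 / p - 1 / q = 1 / 2) :
    ∃ η : ℝ, 0 < η ∧ ∀ u w V : ℝ × ℝ → ℂ, HasWeakDbar u w → MemLp u (ENNReal.ofReal p) →
      MemLp u (ENNReal.ofReal q) → MemLp V 2 → (∀ᵐ z, ‖w z‖ ≤ ‖V z * u z‖) →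
      ∀ (z₀ : ℝ × ℝ) (ρ ε : ℝ), 0 < ρ → 0 < ε →
      eLpNorm ({z | ‖toComplex (z - z₀)‖ < ρ}.indicator V) 2 ≤ ENNReal.ofReal η →
      (∀ᵐ z, ‖toComplex (z - z₀)‖ ≤ ε → u z = 0) →
      ∀ᵐ z, ‖toComplex (z - z₀)‖ < ρ / 2 → u z = 0 := by
  obtain ⟨η, hη, K, hK, hcarleman⟩ := exists_eLpNorm_cauchyKernel_pow_mul_le hp hp2 hq hpq
  refine ⟨η, hη, ?_⟩
  intro u w V huw hup huq hV hw z₀ ρ ε hρ hε hVη hvan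
  have hN := hcarleman u w V huw hup huq hV hw z₀ ρ ε hρ hε hVη hvan
  have hq0 : 0 < q := by linarith
  have := holderTriple_two_ofReal (by linarith) hq0 hpq
  set S : ENNReal := eLpNorm (fun z => V z * u z) (ENNReal.ofReal p) volume with hS
  have hSt : S ≠ ⊤ := (huq.mul hV : MemLp (fun z => V z * u z) (ENNReal.ofReal p) volume).2.ne
  set k : ℝ × ℝ → ℂ := fun z => cauchyKernel ε (z - z₀) with hk
  set D' : Set (ℝ × ℝ) := {z | ‖toComplex (z - z₀)‖ < ρ / 2} with hD'
  have hDm' : MeasurableSet D' := measurableSet_disc z₀ (ρ / 2)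
  have hsmall : ∀ n : ℕ, eLpNorm (D'.indicator u) (ENNReal.ofReal q) ≤
      ENNReal.ofReal ((1 / 2) ^ n) * (K * S) := by
    intro n
    have h1 : eLpNorm (D'.indicator u) (ENNReal.ofReal q) ≤ ENNReal.ofReal ((ρ / 2) ^ n) *
        eLpNorm (fun z => k z ^ n * u z) (ENNReal.ofReal q) := by
      refine eLpNorm_le_mul_eLpNorm_of_ae_le_mul (g := fun z => k z ^ n * u z)
        (hvan.mono fun z hz => ?_) _
      by_cases hzD : z ∈ D'
      · rw [indicator_of_mem hzD]
        rcases le_or_gt ‖toComplex (z - z₀)‖ ε with h | h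
        · rw [hz h]; simp
        · have h0 : 0 < ‖toComplex (z - z₀)‖ := hε.trans h
          rw [hk]
          simp only
          rw [cauchyKernel_eq_inv hε h.le, norm_mul, norm_pow, norm_inv, ← mul_assoc, ← mul_pow,
            ← div_eq_mul_inv]
          refine le_mul_of_one_le_left (norm_nonneg _) (one_le_pow₀ ?_)
          rw [one_le_div h0]
          exact le_of_lt hzD
      · rw [indicator_of_notMem hzD, norm_zero]
        positivity
    refine (h1.trans (mul_le_mul_right (hN n) _)).trans (le_of_eq ?_)
    have e : ENNReal.ofReal ((1 / 2) ^ n) =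
        ENNReal.ofReal ((ρ / 2) ^ n) * ENNReal.ofReal (ρ⁻¹ ^ n) := by
      rw [← ENNReal.ofReal_mul (by positivity), ← mul_pow]
      congr 2
      field_simp
    rw [e]
    ring
  have hlim : Tendsto (fun n : ℕ => ENNReal.ofReal ((1 / 2) ^ n) * (K * S)) atTop (𝓝 0) := by
    have t1 : Tendsto (fun n : ℕ => ENNReal.ofReal ((1 / 2) ^ n)) atTop (𝓝 0) := by
      simpa using ENNReal.tendsto_ofReal
        (tendsto_pow_atTop_nhds_zero_of_lt_one (r := (1 / 2 : ℝ)) (by norm_num) (by norm_num))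
    simpa using ENNReal.Tendsto.mul_const t1
      (Or.inr (ENNReal.mul_ne_top hK hSt))
  have hzero : eLpNorm (D'.indicator u) (ENNReal.ofReal q) = 0 :=
    le_antisymm (ge_of_tendsto' hlim hsmall) bot_le
  rw [eLpNorm_eq_zero_iff (huq.1.indicator hDm') (by simpa using hq0)] at hzero
  filter_upwards [hzero] with z hz hzD
  rwa [indicator_of_mem (by exact hzD)] at hz

theorem theorem1 (p q : ℝ) (hp : 1 < p) (hp2 : p < 2) (hq : 2 < q) (hpq : 1 / p - 1 / q = 1 / 2)
    (u V : ℝ × ℝ → ℂ)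
    (hup : MemLp u (ENNReal.ofReal p) volume) (huq : MemLp u (ENNReal.ofReal q) volume)
    (hV : MemLp V 2 volume)
    (hineq : SatisfiesDbarInequality u V)
    (U : Set (ℝ × ℝ)) (hU : IsOpen U) (hne : U.Nonempty)
    (hvanish : ∀ᵐ z, z ∈ U → u z = 0) :
    ∀ᵐ z, u z = 0 := by
  obtain ⟨w, huw, hw⟩ := hineq
  obtain ⟨η, hη, hlocal⟩ := exists_ae_eq_zero_of_ae_eq_zero_near hp hp2 hq hpq
  obtain ⟨δ, hδ, hVδ⟩ := hV.eLpNorm_indicator_le one_le_two ENNReal.ofNat_ne_top hη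
  set ρ : ℝ := √δ / 2 with hρdef
  have hρ : 0 < ρ := by positivity
  have hVρ : ∀ z₀ : ℝ × ℝ, eLpNorm ({z | ‖toComplex (z - z₀)‖ < ρ}.indicator V) 2 ≤
      ENNReal.ofReal η := fun z₀ => by
    refine hVδ _ (measurableSet_disc z₀ ρ) ?_
    have hsub : {z | ‖toComplex (z - z₀)‖ < ρ} ⊆ Metric.ball z₀ ρ := fun z hz => by
      rw [Metric.mem_ball, dist_eq_norm]
      exact (norm_le_norm_toComplex _).trans_lt hz
    refine (measure_mono hsub).trans ?_
    rw [← Prod.mk.eta (p := z₀), ← ball_prod_same, Measure.volume_eq_prod, Measure.prod_prod,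
      Real.volume_ball, Real.volume_ball, ← ENNReal.ofReal_mul (by positivity)]
    refine ENNReal.ofReal_le_ofReal (le_of_eq ?_)
    rw [hρdef, mul_div_cancel₀ _ two_ne_zero, Real.mul_self_sqrt hδ.le]
  set T : Set (ℝ × ℝ) := {z₀ | ∃ ε > 0, ∀ᵐ z, ‖toComplex (z - z₀)‖ ≤ ε → u z = 0} with hT
  have hstep : ∀ z₀ z₁ : ℝ × ℝ, ‖toComplex (z₁ - z₀)‖ < ρ / 4 → z₀ ∈ T → z₁ ∈ T := by
    rintro z₀ z₁ h ⟨ε, hε, hz⟩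
    refine ⟨ρ / 4, by positivity, ?_⟩
    filter_upwards [hlocal u w V huw hup huq hV hw z₀ ρ ε hρ hε (hVρ z₀) hz] with z hz' hzz
    refine hz' ?_
    calc ‖toComplex (z - z₀)‖ = ‖toComplex (z - z₁) + toComplex (z₁ - z₀)‖ := by
          rw [← map_add, sub_add_sub_cancel]
      _ ≤ ‖toComplex (z - z₁)‖ + ‖toComplex (z₁ - z₀)‖ := norm_add_le _ _
      _ < ρ / 2 := by linarith
  have hnhds : ∀ z₀ : ℝ × ℝ, ∀ᶠ z in 𝓝 z₀, ‖toComplex (z - z₀)‖ < ρ / 4 := fun z₀ => by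
    have hc : Continuous fun z : ℝ × ℝ => ‖toComplex (z - z₀)‖ := by fun_prop
    exact (hc.tendsto z₀).eventually (gt_mem_nhds (by simpa using hρ))
  have hclopen : IsClopen T := by
    constructor
    · rw [← isOpen_compl_iff, isOpen_iff_mem_nhds]
      intro z₀ hz₀
      filter_upwards [hnhds z₀] with z hz hzT
      exact hz₀ (hstep z z₀ (by rwa [← neg_sub, map_neg, norm_neg]) hzT)
    · rw [isOpen_iff_mem_nhds]
      intro z₀ hz₀
      filter_upwards [hnhds z₀] with z hz using hstep z₀ z hz hz₀
  have hTne : T.Nonempty := by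
    obtain ⟨z₀, hz₀⟩ := hne
    obtain ⟨r, hr, hrU⟩ := Metric.isOpen_iff.1 hU z₀ hz₀
    refine ⟨z₀, r / 2, by positivity, hvanish.mono fun z hz h => hz (hrU ?_)⟩
    rw [Metric.mem_ball, dist_eq_norm]
    linarith [norm_le_norm_toComplex (z - z₀)]
  have hTuniv := hclopen.eq_univ hTne
  refine measure_null_of_locally_null _ fun z₀ _ => ?_
  obtain ⟨ε, hε, hz⟩ : z₀ ∈ T := hTuniv ▸ mem_univ z₀
  refine ⟨{z | u z ≠ 0} ∩ {z | ‖toComplex (z - z₀)‖ ≤ ε}, ?_, ?_⟩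
  · refine inter_mem_nhdsWithin _ ?_
    have hc : Continuous fun z : ℝ × ℝ => ‖toComplex (z - z₀)‖ := by fun_prop
    filter_upwards [(hc.tendsto z₀).eventually (gt_mem_nhds (by simpa using hε))] with z h
      using le_of_lt h
  · refine measure_mono_null (fun z hzz => ?_) hz
    exact fun hcon => hzz.1 (hcon hzz.2)
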